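/- For a positive integer $N$, let $E_N$ be the set of configurations $\mathbf L=(L_1,L_2,\dots)$ of non-negative integers with $\sum_n nL_n=N$ ($L_n$ is the number of particles of size $n$). Let $\alpha:\mathbb N\times\mathbb N\to(0,\infty)$ be symmetric, where $\mathbb N=\{1,2,\dots\}$. The Marcus--Lushnikov process $(\mathbf L(t))_{t\ge0}$ of mass $N$ with coagulation rate $\alpha$ is the càdlàg Markov process on $E_N$, with an arbitrary (possibly random) initial configuration, whose infinitesimal generator is $$\mathcal A F(\mathbf L)=\sum_{m,n\ge1}\frac{\alpha(m,n)}{2N}\bigl(L_mL_n-\mathbf 1(m=n)L_m\bigr)\bigl(F(\mathbf L^{m,n})-F(\mathbf L)\bigr),$$ where $\mathbf L^{m,n}$ is obtained from $\mathbf L$ by replacing one particle of size $m$ and another particle of size $n$ by a single particle of size $m+n$. Let $\mathbb E_N$ be the expectation for this process, and for $k\in\mathbb N$ and $\delta\in(0,1)$ put $$T_k(\delta)=\inf\Bigl\{t\ge 0:\ N^{-1}\sum_{n\ge k}nL_n(t)\ge\delta\Bigr\}\in[0,\infty],\qquad \inf\emptyset=\infty .$$ **Theorem.** Let $q\in(1,2)$,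 $s>2-q$, $\eta\in(0,(q-1)/4)$ and $\nu>1$. There exist positive constants $k_0=k_0(q,s,\eta)$ and $C_1=C_1(q,s,\eta,\nu)$ such that the following holds for every symmetric $\alpha$ with $\alpha(m,n)\ge m^q+n^q$ for all $m,n\ge1$, every $\delta\in(0,1)$, every Marcus--Lushnikov process of mass $N$ with coagulation rate $\alpha$, and all positive integers $k>k_0$ and $N$ satisfying $$k^{(k-1)s+2}\le N\le e^{k^\nu},\qquad 2k^{-s}\le1:$$ $$\begin{aligned}\mathbb E_N T_k(\delta)\le{}&\frac{4}{2-q}\,k^{-s+2-q}+8\,k^{s(k-1)+3-q}N^{-1}+\frac{C_1}{1-\delta}\,k^{-\eta}(\log k)^{1-\eta}\\&+\frac{C_1}{1-\delta}\,k^{3-q/2}(\log k)^3N^{-q/(2s(k-1))}.\end{aligned}$$ -/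

import Mathlib

open MeasureTheory ProbabilityTheory Filter Topology
open scoped NNReal ENNReal

namespace MarcusLushnikov

/-- The configurations `L = (L 1, L 2, …)` of total mass `N`: `L n` is the number of particles of
size `n`, and `∑ n, n * L n = N`. Sizes are positive, so the unused coordinate `L 0` is `0`; mass
`N` forces `L n = 0` for `n > N`, so that the sum is finite. -/
def stateSpace (N : ℕ) : Set (ℕ → ℕ) :=
  {L | L 0 = 0 ∧ (∀ n, N < n → L n = 0) ∧ ∑ n ∈ Finset.Icc 1 N, n * L n = N}

/-- The configuration `L^{m,n}` after a particle of size `m` and another particle of size `n`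
have merged (for `m = n` two particles of size `m` are removed). The subtractions are only relevant
when these two particles exist; otherwise the transition has rate `0`. -/
def coagulate (L : ℕ → ℕ) (m n : ℕ) : ℕ → ℕ := fun i =>
  L i - (if i = m then 1 else 0) - (if i = n then 1 else 0) + (if i = m + n then 1 else 0)

/-- The infinitesimal generator of the Marcus–Lushnikov process of total mass `N`,
`(𝓐 F)(L) = ∑_{m,n} α(m,n) / (2N) * (L_m L_n - 1(m = n) L_m) * (F(L^{m,n}) - F(L))`.
Sizes above `N` do not occur in a configuration of mass `N`. -/
noncomputable def generator (α : ℕ → ℕ → ℝ) (N : ℕ) (F : (ℕ → ℕ) → ℝ) (L : ℕ → ℕ) : ℝ :=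
  ∑ m ∈ Finset.Icc 1 N, ∑ n ∈ Finset.Icc 1 N,
    α m n / (2 * (N : ℝ)) * ((L m : ℝ) * (L n : ℝ) - (if m = n then (L m : ℝ) else 0))
      * (F (coagulate L m n) - F L)

/-- `X` is a Marcus–Lushnikov process of total mass `N` with coagulation rate `α` under `μ`:
a process with càdlàg paths in the finite set `stateSpace N` that solves the martingale problem
of `generator α N`, that is, `F (X t) - F (X 0) - ∫₀ᵗ (𝓐 F)(X r) dr` is a martingale in the natural
filtration of `X`, for every function `F` of the configuration. As the state space is finite, this
is the same as being the Markov process with infinitesimal generator `𝓐`. The law of the initial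
configuration `X 0` is arbitrary. -/
structure IsMarcusLushnikov (α : ℕ → ℕ → ℝ) (N : ℕ) {Ω : Type*} [MeasurableSpace Ω]
    (μ : Measure Ω) (X : ℝ≥0 → Ω → (ℕ → ℕ)) : Prop where
  mem_stateSpace : ∀ t ω, X t ω ∈ stateSpace N
  stronglyMeasurable : ∀ t, StronglyMeasurable (X t)
  rightContinuous : ∀ ω t, ContinuousWithinAt (fun r => X r ω) (Set.Ici t) t
  leftLimits : ∀ ω t, ∃ l, Tendsto (fun r => X r ω) (𝓝[<] t) (𝓝 l)
  martingale : ∀ F : (ℕ → ℕ) → ℝ,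
    Martingale
      (fun (t : ℝ≥0) ω => F (X t ω) - F (X 0 ω)
        - ∫ r in (0 : ℝ)..(t : ℝ), generator α N F (X r.toNNReal ω))
      (Filtration.natural X stronglyMeasurable) μ

/-- The fraction `N⁻¹ ∑_{n ≥ k} n L_n` of the mass carried by the particles of size at least `k`,
for a configuration of total mass `N` (in which no particle is larger than `N`). -/
noncomputable def massFraction (N k : ℕ) (L : ℕ → ℕ) : ℝ :=
  (N : ℝ)⁻¹ * ∑ n ∈ Finset.Icc k N, (n : ℝ) * (L n : ℝ)

/-- `T_k(δ) = inf {t : N⁻¹ ∑_{n ≥ k} n L_n(t) ≥ δ}`, with value `∞` if there is no such `t`. -/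
noncomputable def hittingTime {Ω : Type*} (N : ℕ) (X : ℝ≥0 → Ω → (ℕ → ℕ)) (k : ℕ) (δ : ℝ)
    (ω : Ω) : ℝ≥0∞ :=
  sInf ((fun t : ℝ≥0 => (t : ℝ≥0∞)) '' {t : ℝ≥0 | δ ≤ massFraction N k (X t ω)})

end MarcusLushnikov

/-! The proof builds a bounded nonnegative Lyapunov function that no merger increases and whose
drift is at most `-1` while the mass fraction in sizes at least `k` is below `δ`. By the martingale
property the mean hitting time is then at most its supremum (`lintegral_hittingTime_le`).

Let `r = k^(-s)`, let `S_j` be the mass in sizes below `j` and `M` the largest size. The function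
weighs the positive parts of `S_(l+1)/N - (1 - r^l - l/N)`, for `l < k`, by `4 l^(1-q) r^(-(l-1))`,
and adds a multiple of `max(k, M)^(1-q)`. There are two regimes.

If `S_k/N > 1 - r^(k-1)`, some size `l < k` carries mass fraction of order `r^(l-1)`, and its
mergers, at rate at least of order `l^(q-1)` per particle, drain the `l`-th term
(`generator_lyapunov_le_of_smallMass_gt`). Otherwise a particle of size at least `k` exists, and the
largest one absorbs small particles at rate at least of order `M^q`, which lowers `M^(1-q)` at a
rate bounded below independently of `M` (`generator_lyapunov_le_of_smallMass_lt`).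

The supremum of the sum gives the first two terms of the bound (`sum_chain_le`), and `k^(1-q)` is
absorbed by the third. -/

namespace MarcusLushnikov

/-! ### Regularity of paths in a finite state space -/

section Paths

variable {Ω : Type*} {N : ℕ}

theorem apply_le_of_mem_stateSpace {L : ℕ → ℕ} (hL : L ∈ stateSpace N) (n : ℕ) : L n ≤ N := by
  obtain ⟨h0, h1, h2⟩ := hL
  by_cases hn : n ∈ Finset.Icc 1 N
  · have := Finset.single_le_sum (f := fun n => n * L n) (fun _ _ => Nat.zero_le _) hn
    have hn1 := (Finset.mem_Icc.1 hn).1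
    simp only [h2] at this
    nlinarith
  · rcases Nat.eq_zero_or_pos n with rfl | hpos
    · simp [h0]
    · rw [h1 n]
      · exact Nat.zero_le _
      · simp only [Finset.mem_Icc] at hn
        omega

theorem finite_stateSpace (N : ℕ) : (stateSpace N).Finite := by
  refine Set.Finite.of_injOn (f := fun L (i : Fin (N + 1)) => L i)
    (t := Set.univ.pi fun _ => Set.Iic N) ?_ ?_ (Set.Finite.pi fun _ => Set.finite_Iic N)
  · intro L hL i _
    exact apply_le_of_mem_stateSpace hL i
  · intro L hL L' hL' h
    funext n
    by_cases hn : n < N + 1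
    · exact congrFun h ⟨n, hn⟩
    · rw [hL.2.1 n (by omega), hL'.2.1 n (by omega)]

/-- A right-continuous path in the state space is locally constant to the right. -/
theorem eventually_eq_of_continuousWithinAt {x : ℝ≥0 → ℕ → ℕ} (hx : ∀ t, x t ∈ stateSpace N)
    {t : ℝ≥0} (hc : ContinuousWithinAt x (Set.Ici t) t) :
    ∀ᶠ r in 𝓝[Set.Ici t] t, x r = x t := by
  have h : ∀ n ∈ Finset.range (N + 1), ∀ᶠ r in 𝓝[Set.Ici t] t, x r n = x t n := by
    intro n _
    have := (continuous_apply n).continuousAt.comp_continuousWithinAt hc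
    exact this.eventually (show ∀ᶠ y in 𝓝 (x t n), y = x t n from
      (nhds_discrete ℕ).symm ▸ (by simp))
  filter_upwards [(Filter.eventually_all_finset _).2 h] with r hr
  funext n
  by_cases hn : n < N + 1
  · exact hr n (Finset.mem_range.2 hn)
  · rw [(hx r).2.1 n (by omega), (hx t).2.1 n (by omega)]

/-- A real function of a right-continuous path in the state space is measurable in time. -/
theorem measurable_comp_path {x : ℝ≥0 → ℕ → ℕ} (hx : ∀ t, x t ∈ stateSpace N)
    (hc : ∀ t, ContinuousWithinAt x (Set.Ici t) t) (H : (ℕ → ℕ) → ℝ) :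
    Measurable fun t => H (x t) := by
  -- The point of the grid of mesh `1/(n+1)` just to the right of `t`. The path sampled there is a
  -- function of an integer floor, hence measurable, and right-continuity gives the limit.
  let u : ℕ → ℝ≥0 → ℝ≥0 := fun n t => ((⌊((n : ℝ≥0) + 1) * t⌋₊ : ℝ≥0) + 1) / ((n : ℝ≥0) + 1)
  have hle : ∀ n t, t ≤ u n t := by
    intro n t
    rw [le_div_iff₀ (by positivity), mul_comm]
    exact (Nat.lt_floor_add_one _).le
  have hge : ∀ n t, u n t ≤ t + 1 / ((n : ℝ≥0) + 1) := by
    intro n t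
    have h : (0 : ℝ≥0) < (n : ℝ≥0) + 1 := by positivity
    have hfl : (⌊((n : ℝ≥0) + 1) * t⌋₊ : ℝ≥0) ≤ ((n : ℝ≥0) + 1) * t := Nat.floor_le (zero_le)
    calc u n t ≤ (((n : ℝ≥0) + 1) * t + 1) / ((n : ℝ≥0) + 1) := by
          simp only [u]
          gcongr
      _ = t + 1 / ((n : ℝ≥0) + 1) := by field_simp
  have hu : ∀ t, Tendsto (fun n => u n t) atTop (𝓝[Set.Ici t] t) := by
    intro t
    refine tendsto_nhdsWithin_iff.2 ⟨?_, Eventually.of_forall fun n => hle n t⟩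
    refine tendsto_of_tendsto_of_tendsto_of_le_of_le tendsto_const_nhds ?_
      (fun n => hle n t) (fun n => hge n t)
    have : Tendsto (fun n : ℕ => 1 / ((n : ℝ≥0) + 1)) atTop (𝓝 0) :=
      tendsto_one_div_add_atTop_nhds_zero_nat
    simpa using tendsto_const_nhds.add this
  refine measurable_of_tendsto_metrizable (f := fun n t => H (x (u n t))) ?_ ?_
  · intro n
    have h1 : Measurable fun t : ℝ≥0 => ⌊((n : ℝ≥0) + 1) * t⌋₊ :=
      Nat.measurable_floor.comp (measurable_const.mul measurable_id)
    exact (measurable_from_nat (f := fun j : ℕ =>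
      H (x (((j : ℝ≥0) + 1) / ((n : ℝ≥0) + 1))))).comp h1
  · refine tendsto_pi_nhds.2 fun t => ?_
    refine tendsto_const_nhds.congr' ?_
    filter_upwards [(hu t).eventually (eventually_eq_of_continuousWithinAt hx (hc t))] with n hn
    rw [hn]

theorem intervalIntegrable_comp_path {x : ℝ≥0 → ℕ → ℕ} (hx : ∀ t, x t ∈ stateSpace N)
    (hc : ∀ t, ContinuousWithinAt x (Set.Ici t) t) (H : (ℕ → ℕ) → ℝ) (a b : ℝ) :
    IntervalIntegrable (fun r : ℝ => H (x r.toNNReal)) volume a b := by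
  obtain ⟨B, hB⟩ := ((finite_stateSpace N).image fun L => ‖H L‖).bddAbove
  have hmeas : Measurable fun r : ℝ => H (x r.toNNReal) :=
    (measurable_comp_path hx hc H).comp measurable_real_toNNReal
  refine (intervalIntegrable_const (c := B)).mono_fun hmeas.aestronglyMeasurable ?_
  refine Eventually.of_forall fun r => ?_
  exact (hB ⟨_, hx _, rfl⟩).trans (le_abs_self B)

end Paths

/-! ### From drift to mean hitting time -/

/-- If `F` is a Lyapunov function, decreasing at rate at least `1` as long as the mass carried by
particles of size at least `k` is below `δ`, then the hitting time has mean at most `sup F`. -/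
theorem lintegral_hittingTime_le {α : ℕ → ℕ → ℝ} {N k : ℕ} {δ B : ℝ} {Ω : Type*}
    [MeasurableSpace Ω] {μ : Measure Ω} [IsProbabilityMeasure μ] {X : ℝ≥0 → Ω → (ℕ → ℕ)}
    (hX : IsMarcusLushnikov α N μ X) (F : (ℕ → ℕ) → ℝ) (hF0 : ∀ L, 0 ≤ F L)
    (hFB : ∀ L ∈ stateSpace N, F L ≤ B)
    (hgen : ∀ L ∈ stateSpace N, generator α N F L ≤ 0)
    (hgen' : ∀ L ∈ stateSpace N, massFraction N k L < δ → generator α N F L ≤ -1) :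
    ∫⁻ ω, hittingTime N X k δ ω ∂μ ≤ ENNReal.ofReal B := by
  set I : ℕ → Ω → ℝ := fun n ω =>
    ∫ r in (0 : ℝ)..(n : ℝ), -generator α N F (X r.toNNReal ω) with hI
  have hint : ∀ ω a b, IntervalIntegrable (fun r : ℝ => -generator α N F (X r.toNNReal ω))
      volume a b := fun ω a b =>
    (intervalIntegrable_comp_path (fun t => hX.mem_stateSpace t ω) (hX.rightContinuous ω)
      (generator α N F) a b).neg
  have hFint : ∀ t, Integrable (fun ω => F (X t ω)) μ := by
    intro t
    have hm : Measurable fun ω => (⟨X t ω, hX.mem_stateSpace t ω⟩ : stateSpace N) :=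
      (hX.stronglyMeasurable t).measurable.subtype_mk
    -- `F` need not be measurable on all configurations; countability of the state space makes its
    -- restriction measurable.
    have : Countable (stateSpace N) := (finite_stateSpace N).countable.to_subtype
    have hm' : Measurable fun ω => F (X t ω) :=
      (measurable_of_countable fun L : stateSpace N => F L).comp hm
    refine Integrable.of_bound hm'.aestronglyMeasurable B (Eventually.of_forall fun ω => ?_)
    rw [Real.norm_of_nonneg (hF0 _)]
    exact hFB _ (hX.mem_stateSpace t ω)
  set Mt : ℝ≥0 → Ω → ℝ := fun t ω => F (X t ω) - F (X 0 ω)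
        - ∫ r in (0 : ℝ)..(t : ℝ), generator α N F (X r.toNNReal ω) with hMt
  have hmart : Martingale Mt (Filtration.natural X hX.stronglyMeasurable) μ := hX.martingale F
  have hIeq : ∀ n : ℕ, ∀ ω, I n ω = Mt (n : ℝ≥0) ω - F (X (n : ℝ≥0) ω) + F (X 0 ω) := by
    intro n ω
    simp only [hI, hMt, intervalIntegral.integral_neg, NNReal.coe_natCast]
    ring
  have hIint : ∀ n, Integrable (I n) μ := by
    intro n
    rw [funext (hIeq n)]
    exact ((hmart.integrable _).sub (hFint _)).add (hFint _)
  have hImean : ∀ n, ∫ ω, I n ω ∂μ ≤ B := by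
    intro n
    have h0 : ∫ ω, Mt (n : ℝ≥0) ω ∂μ = 0 := by
      have := hmart.setIntegral_eq (zero_le (a := (n : ℝ≥0))) MeasurableSet.univ
      rw [setIntegral_univ, setIntegral_univ] at this
      rw [← this]
      simp [hMt]
    simp only [hIeq]
    have h3 := integral_add ((hmart.integrable (n : ℝ≥0)).sub (hFint n)) (hFint 0)
    have h4 := integral_sub (hmart.integrable (n : ℝ≥0)) (hFint n)
    simp only [Pi.sub_apply] at h3
    rw [h3, h4, h0]
    have h1 : 0 ≤ ∫ ω, F (X (n : ℝ≥0) ω) ∂μ := integral_nonneg fun ω => hF0 _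
    have h2 : ∫ ω, F (X 0 ω) ∂μ ≤ ∫ _, B ∂μ :=
      integral_mono (hFint 0) (integrable_const B) fun ω => hFB _ (hX.mem_stateSpace 0 ω)
    simp only [integral_const, probReal_univ, one_smul] at h2
    linarith
  have hnonneg : ∀ ω r, 0 ≤ -generator α N F (X r ω) := fun ω r => by
    have := hgen _ (hX.mem_stateSpace r ω)
    linarith
  have hI0 : ∀ n ω, 0 ≤ I n ω := fun n ω =>
    intervalIntegral.integral_nonneg (Nat.cast_nonneg n) fun r _ => hnonneg ω _
  have hmono : Monotone fun n ω => ENNReal.ofReal (I n ω) := by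
    intro n m hnm ω
    refine ENNReal.ofReal_le_ofReal ?_
    exact intervalIntegral.integral_mono_interval le_rfl (Nat.cast_nonneg n)
      (by exact_mod_cast hnm) (Eventually.of_forall fun r => hnonneg ω _) (hint ω _ _)
  -- Before the hitting time the integrand is at least `1`, so `I n` dominates `min(T, n)`. Monotone
  -- convergence then replaces optional stopping.
  have hlow : ∀ ω, ∀ n : ℕ, ∀ c : ℝ≥0, (c : ℝ≥0∞) ≤ hittingTime N X k δ ω → c ≤ n →
      (c : ℝ) ≤ I n ω := by
    intro ω n c hc hcn
    have h1 : ∫ r in (0 : ℝ)..c, (1 : ℝ) ≤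
        ∫ r in (0 : ℝ)..c, -generator α N F (X r.toNNReal ω) := by
      refine intervalIntegral.integral_mono_on_of_le_Ioo c.coe_nonneg
        intervalIntegrable_const (hint ω _ _) fun r hr => ?_
      have : massFraction N k (X r.toNNReal ω) < δ := by
        by_contra! h
        have h2 : hittingTime N X k δ ω ≤ (r.toNNReal : ℝ≥0∞) := sInf_le ⟨_, h, rfl⟩
        have h3 : c ≤ r.toNNReal := by exact_mod_cast hc.trans h2
        have h4 := (Real.le_toNNReal_iff_coe_le hr.1.le).1 h3
        exact absurd hr.2 (not_lt.2 h4)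
      have := hgen' _ (hX.mem_stateSpace r.toNNReal ω) this
      linarith
    have h2 : ∫ r in (0 : ℝ)..c, -generator α N F (X r.toNNReal ω) ≤ I n ω :=
      intervalIntegral.integral_mono_interval le_rfl c.coe_nonneg
        (by exact_mod_cast hcn) (Eventually.of_forall fun r => hnonneg ω _) (hint ω _ _)
    simpa using h1.trans h2
  have hle : ∀ ω, hittingTime N X k δ ω ≤ ⨆ n, ENNReal.ofReal (I n ω) := by
    intro ω
    refine ENNReal.le_of_forall_nnreal_lt fun c hc => ?_
    obtain ⟨n, hn⟩ := exists_nat_ge c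
    refine le_iSup_of_le n ?_
    rw [← ENNReal.ofReal_coe_nnreal]
    exact ENNReal.ofReal_le_ofReal (hlow ω n c hc.le hn)
  calc ∫⁻ ω, hittingTime N X k δ ω ∂μ ≤ ∫⁻ ω, ⨆ n, ENNReal.ofReal (I n ω) ∂μ :=
        lintegral_mono hle
    _ = ⨆ n, ∫⁻ ω, ENNReal.ofReal (I n ω) ∂μ :=
        lintegral_iSup' (fun n => (hIint n).aemeasurable.ennreal_ofReal)
          (Eventually.of_forall fun ω n m hnm => hmono hnm ω)
    _ ≤ ENNReal.ofReal B := by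
        refine iSup_le fun n => ?_
        rw [← ofReal_integral_eq_lintegral_ofReal (hIint n) (Eventually.of_forall (hI0 n))]
        exact ENNReal.ofReal_le_ofReal (hImean n)

/-! ### Effect of a single merger -/

/-- The configuration has two distinct particles of sizes `m` and `n`. -/
def CanMerge (L : ℕ → ℕ) (m n : ℕ) : Prop := 1 ≤ L m ∧ 1 ≤ L n ∧ (m = n → 2 ≤ L m)

/-- The mass carried by the particles of size less than `j`. -/
def smallMass (L : ℕ → ℕ) (j : ℕ) : ℝ := ∑ n ∈ Finset.range j, (n : ℝ) * (L n : ℝ)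

/-- The largest size at most `2 * N` of a particle. -/
def maxSize (N : ℕ) (L : ℕ → ℕ) : ℕ := ((Finset.Icc 1 (2 * N)).filter fun n => L n ≠ 0).sup id

/-- The rate of the transition to `coagulate L m n`. -/
noncomputable def mergeRate (α : ℕ → ℕ → ℝ) (N : ℕ) (L : ℕ → ℕ) (m n : ℕ) : ℝ :=
  α m n / (2 * (N : ℝ)) * ((L m : ℝ) * (L n : ℝ) - (if m = n then (L m : ℝ) else 0))

theorem pairCount_nonneg (L : ℕ → ℕ) (m n : ℕ) :
    0 ≤ (L m : ℝ) * (L n : ℝ) - (if m = n then (L m : ℝ) else 0) := by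
  split_ifs with h
  · subst h
    rcases Nat.eq_zero_or_pos (L m) with h0 | h0
    · simp [h0]
    · have : (1 : ℝ) ≤ L m := by exact_mod_cast h0
      nlinarith
  · simp only [sub_zero]
    positivity

theorem mergeRate_nonneg {α : ℕ → ℕ → ℝ} {m n : ℕ} (h : 0 ≤ α m n) (N : ℕ) (L : ℕ → ℕ) :
    0 ≤ mergeRate α N L m n :=
  mul_nonneg (by positivity) (pairCount_nonneg L m n)

/-- Hence the truncated subtractions in `coagulate` never influence the generator. -/
theorem mergeRate_eq_zero {L : ℕ → ℕ} {m n : ℕ} (h : ¬ CanMerge L m n) (α : ℕ → ℕ → ℝ) (N : ℕ) :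
    mergeRate α N L m n = 0 := by
  unfold mergeRate
  rw [mul_eq_zero]
  right
  by_cases hm : L m = 0
  · simp [hm]
  by_cases hn : L n = 0
  · split_ifs with e
    · exact absurd (e ▸ hn) hm
    · simp [hn]
  by_cases e : m = n
  · subst e
    have : L m = 1 := by
      unfold CanMerge at h
      by_contra h1
      exact h ⟨by omega, by omega, fun _ => by omega⟩
    simp [this]
  · exact absurd ⟨by omega, by omega, fun h => absurd h e⟩ h

/-- Bound the generator by the contribution of the mergers involving a fixed size. -/
theorem generator_le_neg_sum {α : ℕ → ℕ → ℝ} {N : ℕ} {F : (ℕ → ℕ) → ℝ} {L : ℕ → ℕ}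
    (hα : ∀ m n, 1 ≤ m → 1 ≤ n → 0 ≤ α m n)
    (hF : ∀ m ∈ Finset.Icc 1 N, ∀ n ∈ Finset.Icc 1 N, CanMerge L m n →
      F (coagulate L m n) ≤ F L)
    {j : ℕ} (hj : j ∈ Finset.Icc 1 N) (d : ℕ → ℝ)
    (hd : ∀ n ∈ Finset.Icc 1 N, CanMerge L j n → F (coagulate L j n) ≤ F L - d n) :
    generator α N F L ≤ -∑ n ∈ Finset.Icc 1 N, mergeRate α N L j n * d n := by
  have hrate : ∀ m ∈ Finset.Icc 1 N, ∀ n ∈ Finset.Icc 1 N, 0 ≤ mergeRate α N L m n :=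
    fun m hm n hn => mergeRate_nonneg
      (hα m n (Finset.mem_Icc.1 hm).1 (Finset.mem_Icc.1 hn).1) N L
  have hneg : ∀ m ∈ Finset.Icc 1 N,
      0 ≤ -∑ n ∈ Finset.Icc 1 N, mergeRate α N L m n * (F (coagulate L m n) - F L) := by
    intro m hm
    rw [neg_nonneg]
    refine Finset.sum_nonpos fun n hn => ?_
    by_cases h : CanMerge L m n
    · exact mul_nonpos_of_nonneg_of_nonpos (hrate m hm n hn) (by linarith [hF m hm n hn h])
    · rw [mergeRate_eq_zero h, zero_mul]
  have h1 := Finset.single_le_sum hneg hj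
  rw [Finset.sum_neg_distrib] at h1
  have h2 : generator α N F L = ∑ m ∈ Finset.Icc 1 N, ∑ n ∈ Finset.Icc 1 N,
      mergeRate α N L m n * (F (coagulate L m n) - F L) := rfl
  rw [← h2] at h1
  refine (neg_le_neg_iff.1 h1).trans ?_
  rw [← Finset.sum_neg_distrib]
  refine Finset.sum_le_sum fun n hn => ?_
  by_cases h : CanMerge L j n
  · rw [← mul_neg]
    exact mul_le_mul_of_nonneg_left (by linarith [hd n hn h]) (hrate j hj n hn)
  · rw [mergeRate_eq_zero h, zero_mul, zero_mul, neg_zero]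

theorem sum_range_mul_indicator (j m : ℕ) :
    ∑ i ∈ Finset.range j, (i : ℝ) * (if i = m then 1 else 0) = if m < j then (m : ℝ) else 0 := by
  simp [Finset.sum_ite_eq']

theorem smallMass_coagulate {L : ℕ → ℕ} {m n : ℕ} (h : CanMerge L m n) (j : ℕ) :
    smallMass (coagulate L m n) j = smallMass L j - (if m < j then (m : ℝ) else 0)
      - (if n < j then (n : ℝ) else 0) + (if m + n < j then ((m + n : ℕ) : ℝ) else 0) := by
  have key : ∀ i, (coagulate L m n i : ℝ) = (L i : ℝ) - (if i = m then 1 else 0)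
      - (if i = n then 1 else 0) + (if i = m + n then 1 else 0) := by
    intro i
    obtain ⟨hm, hn, hmn⟩ := h
    have h1 : (if i = m then 1 else 0) + (if i = n then 1 else 0) ≤ L i := by
      split_ifs with a b b
      · subst a; subst b; exact hmn rfl
      · subst a; simpa using hm
      · subst b; simpa using hn
      · simp
    unfold coagulate
    rw [Nat.cast_add, Nat.cast_sub (by omega), Nat.cast_sub (by omega)]
    push_cast
    ring
  rw [← sum_range_mul_indicator j m, ← sum_range_mul_indicator j n,
    ← sum_range_mul_indicator j (m + n)]
  unfold smallMass
  rw [← Finset.sum_sub_distrib, ← Finset.sum_sub_distrib, ← Finset.sum_add_distrib]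
  refine Finset.sum_congr rfl fun i _ => ?_
  rw [key]
  ring

/-- Mergers move mass only upwards: if `m + n < j`, then both `m < j` and `n < j`. -/
theorem smallMass_coagulate_le {L : ℕ → ℕ} {m n : ℕ} (h : CanMerge L m n) (j : ℕ) :
    smallMass (coagulate L m n) j ≤ smallMass L j := by
  rw [smallMass_coagulate h]
  have hm : (0 : ℝ) ≤ m := Nat.cast_nonneg m
  have hn : (0 : ℝ) ≤ n := Nat.cast_nonneg n
  split_ifs <;> first | omega | (push_cast; linarith)

theorem smallMass_coagulate_succ_le {L : ℕ → ℕ} {m n : ℕ} (h : CanMerge L m n) (hn : 1 ≤ n) :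
    smallMass (coagulate L m n) (m + 1) ≤ smallMass L (m + 1) - m := by
  rw [smallMass_coagulate h, if_pos (Nat.lt_succ_self m), if_neg (by omega : ¬ m + n < m + 1)]
  have hn : (0 : ℝ) ≤ n := Nat.cast_nonneg n
  split_ifs <;> linarith

theorem le_maxSize {N : ℕ} {L : ℕ → ℕ} {n : ℕ} (h1 : 1 ≤ n) (h2 : n ≤ 2 * N) (h : L n ≠ 0) :
    n ≤ maxSize N L :=
  Finset.le_sup (f := id) (Finset.mem_filter.2 ⟨Finset.mem_Icc.2 ⟨h1, h2⟩, h⟩)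

theorem coagulate_add_ne_zero (L : ℕ → ℕ) (m n : ℕ) : coagulate L m n (m + n) ≠ 0 := by
  simp [coagulate]

/-- The cutoff `2 * N` in `maxSize` leaves room for `m + n`, so `L` and its successor need not be
known to lie in the state space. -/
theorem add_le_maxSize_coagulate {N : ℕ} (L : ℕ → ℕ) {m n : ℕ} (hm : m ∈ Finset.Icc 1 N)
    (hn : n ∈ Finset.Icc 1 N) : m + n ≤ maxSize N (coagulate L m n) := by
  rw [Finset.mem_Icc] at hm hn
  exact le_maxSize (by omega) (by omega) (coagulate_add_ne_zero L m n)

theorem maxSize_le_coagulate {N : ℕ} (L : ℕ → ℕ) {m n : ℕ} (hm : m ∈ Finset.Icc 1 N)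
    (hn : n ∈ Finset.Icc 1 N) : maxSize N L ≤ maxSize N (coagulate L m n) := by
  refine Finset.sup_le fun i hi => ?_
  obtain ⟨hi1, hi2⟩ := Finset.mem_filter.1 hi
  rw [Finset.mem_Icc] at hi1
  have hadd := add_le_maxSize_coagulate L hm hn
  simp only [id]
  by_cases h : i = m ∨ i = n
  · omega
  · push Not at h
    refine le_maxSize hi1.1 hi1.2 ?_
    simp [coagulate, h.1, h.2, hi2]

/-! ### Mass conservation and merger rates -/

section StateSpace

variable {N : ℕ} {L : ℕ → ℕ}

theorem smallMass_succ (L : ℕ → ℕ) (j : ℕ) :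
    smallMass L (j + 1) = smallMass L j + (j : ℝ) * (L j : ℝ) :=
  Finset.sum_range_succ _ _

theorem sum_Icc_eq_of_mem_stateSpace (hL : L ∈ stateSpace N) :
    ∑ n ∈ Finset.Icc 1 N, (n : ℝ) * (L n : ℝ) = N := by
  exact_mod_cast hL.2.2

theorem smallMass_add_sum_Icc (hL : L ∈ stateSpace N) {k : ℕ} (hk : k ≤ N) :
    smallMass L k + ∑ n ∈ Finset.Icc k N, (n : ℝ) * (L n : ℝ) = N := by
  rw [← sum_Icc_eq_of_mem_stateSpace hL]
  unfold smallMass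
  rw [Finset.range_eq_Ico, ← Finset.Ico_add_one_right_eq_Icc k,
    Finset.sum_Ico_consecutive _ (Nat.zero_le k) (by omega),
    Finset.sum_eq_sum_Ico_succ_bot (by omega), ← Finset.Ico_add_one_right_eq_Icc 1]
  simp

theorem smallMass_le (hL : L ∈ stateSpace N) {k : ℕ} (hk : k ≤ N) : smallMass L k ≤ N := by
  have h1 := smallMass_add_sum_Icc hL hk
  have h2 : 0 ≤ ∑ n ∈ Finset.Icc k N, (n : ℝ) * (L n : ℝ) :=
    Finset.sum_nonneg fun _ _ => by positivity
  linarith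

theorem massFraction_eq (hL : L ∈ stateSpace N) {k : ℕ} (hk : k ≤ N) (hN : 0 < N) :
    massFraction N k L = 1 - smallMass L k / N := by
  have h1 := smallMass_add_sum_Icc hL hk
  have hN' : (N : ℝ) ≠ 0 := by positivity
  unfold massFraction
  field_simp
  linarith

/-- If not all of the mass is in particles of size less than `k`, the largest particle has size at
least `k`. -/
theorem maxSize_spec (hL : L ∈ stateSpace N) {k : ℕ} (hk1 : 1 ≤ k) (hk : k ≤ N)
    (h : smallMass L k < N) :
    k ≤ maxSize N L ∧ maxSize N L ≤ N ∧ L (maxSize N L) ≠ 0 := by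
  have h1 := smallMass_add_sum_Icc hL hk
  have h2 : 0 < ∑ n ∈ Finset.Icc k N, (n : ℝ) * (L n : ℝ) := by linarith
  obtain ⟨n, hn, hne⟩ := Finset.exists_ne_zero_of_sum_ne_zero h2.ne'
  rw [Finset.mem_Icc] at hn
  have hLn : L n ≠ 0 := fun h0 => hne (by simp [h0])
  have h3 : n ≤ maxSize N L := le_maxSize (by omega) (by omega) hLn
  have hmem : n ∈ (Finset.Icc 1 (2 * N)).filter fun n => L n ≠ 0 :=
    Finset.mem_filter.2 ⟨Finset.mem_Icc.2 ⟨by omega, by omega⟩, hLn⟩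
  have h4 : maxSize N L ∈ (Finset.Icc 1 (2 * N)).filter fun n => L n ≠ 0 := by
    obtain ⟨i, hi, hie⟩ := Finset.exists_mem_eq_sup _ ⟨n, hmem⟩ (id : ℕ → ℕ)
    unfold maxSize
    rw [hie]
    exact hi
  have h5 := (Finset.mem_filter.1 h4).2
  refine ⟨by omega, ?_, h5⟩
  by_contra h6
  exact h5 (hL.2.1 _ (by omega))

/-- Each particle merges at total rate at least of the order of its size to the power `q - 1`. -/
theorem le_sum_mergeRate {α : ℕ → ℕ → ℝ} {q : ℝ} (hq : 1 < q) (hL : L ∈ stateSpace N)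
    (hα : ∀ m n : ℕ, 1 ≤ m → 1 ≤ n → (m : ℝ) ^ q + (n : ℝ) ^ q ≤ α m n)
    {j : ℕ} (hj : j ∈ Finset.Icc 1 N) :
    (j : ℝ) ^ (q - 1) / (2 * N) * (L j * (N - j)) ≤ ∑ n ∈ Finset.Icc 1 N, mergeRate α N L j n := by
  have hj1 : (1 : ℝ) ≤ j := by exact_mod_cast (Finset.mem_Icc.1 hj).1
  have hlow : ∀ n ∈ Finset.Icc 1 N, (j : ℝ) ^ (q - 1) / (2 * N) *
      ((n : ℝ) * ((L j : ℝ) * (L n : ℝ) - (if j = n then (L j : ℝ) else 0)))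
      ≤ mergeRate α N L j n := by
    intro n hn
    have hn1 : (1 : ℝ) ≤ n := by exact_mod_cast (Finset.mem_Icc.1 hn).1
    -- The left side is at most the `q`-th power of the larger of `j` and `n`. Being linear in `n`,
    -- it sums to the total mass; the self-pair correction accounts for the `- j`.
    have hsum : (j : ℝ) ^ (q - 1) * n ≤ α j n := by
      refine le_trans ?_ (hα j n (Finset.mem_Icc.1 hj).1 (Finset.mem_Icc.1 hn).1)
      have ej : (j : ℝ) ^ q = (j : ℝ) ^ (q - 1) * j := by
        rw [← Real.rpow_add_one (by positivity)]; ring_nf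
      have en : (n : ℝ) ^ q = (n : ℝ) ^ (q - 1) * n := by
        rw [← Real.rpow_add_one (by positivity)]; ring_nf
      rcases le_total (n : ℝ) j with h | h
      · have : (j : ℝ) ^ (q - 1) * n ≤ (j : ℝ) ^ q := by rw [ej]; gcongr
        have h0 : 0 ≤ (n : ℝ) ^ q := by positivity
        linarith
      · have : (j : ℝ) ^ (q - 1) * n ≤ (n : ℝ) ^ q := by
          rw [en]
          have := Real.rpow_le_rpow (by positivity) h (by linarith : 0 ≤ q - 1)
          gcongr
        have h0 : 0 ≤ (j : ℝ) ^ q := by positivity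
        linarith
    unfold mergeRate
    rw [← mul_assoc, div_mul_eq_mul_div]
    refine mul_le_mul_of_nonneg_right ?_ (pairCount_nonneg L j n)
    gcongr
  refine le_trans (le_of_eq ?_) (Finset.sum_le_sum hlow)
  rw [← Finset.mul_sum]
  congr 1
  have : ∀ n ∈ Finset.Icc 1 N, (n : ℝ) * ((L j : ℝ) * (L n : ℝ) - (if j = n then (L j : ℝ) else 0))
      = (L j : ℝ) * ((n : ℝ) * L n) - (if j = n then (n : ℝ) * (L j : ℝ) else 0) := by
    intro n _
    split_ifs <;> ring
  rw [Finset.sum_congr rfl this, Finset.sum_sub_distrib, ← Finset.mul_sum,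
    sum_Icc_eq_of_mem_stateSpace hL, Finset.sum_ite_eq, if_pos hj]
  ring

end StateSpace

/-! ### Two power inequalities -/

/-- The convex function `x^(1-q)` lies above its tangent at `y`. This is obtained by inverting
Bernoulli's inequality for the exponent `q - 1` in `(0, 1)`. -/
theorem rpow_one_sub_sub_ge {q x y : ℝ} (hq1 : 1 < q) (hq2 : q < 2) (hx : 0 < x) (hxy : x ≤ y) :
    (q - 1) * (y - x) * y ^ (-q) ≤ x ^ (1 - q) - y ^ (1 - q) := by
  have hy : 0 < y := hx.trans_le hxy
  set w := x / y with hw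
  have hw0 : 0 < w := by positivity
  have hw1 : w ≤ 1 := (div_le_one hy).2 hxy
  have h1 : w ^ (q - 1) ≤ 1 + (q - 1) * (w - 1) := by
    have := rpow_one_add_le_one_add_mul_self (s := w - 1) (by linarith) (p := q - 1)
      (by linarith) (by linarith)
    simpa using this
  have h2 : 1 - (q - 1) * (w - 1) ≤ w ^ (1 - q) := by
    have hpos : 0 < w ^ (q - 1) := by positivity
    have : w ^ (1 - q) = (w ^ (q - 1))⁻¹ := by rw [← Real.rpow_neg hw0.le]; ring_nf
    rw [this, le_inv_comm₀ (by nlinarith) hpos]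
    refine h1.trans ?_
    rw [← one_div, le_div_iff₀ (by nlinarith)]
    nlinarith [sq_nonneg ((q - 1) * (w - 1))]
  have hx' : x = w * y := by rw [hw]; field_simp
  have e1 : x ^ (1 - q) = w ^ (1 - q) * y ^ (1 - q) := by rw [hx', Real.mul_rpow hw0.le hy.le]
  have e2 : y ^ (1 - q) = y * y ^ (-q) := by
    rw [sub_eq_add_neg, Real.rpow_add hy, Real.rpow_one]
  have hy0 : 0 < y ^ (1 - q) := by positivity
  calc (q - 1) * (y - x) * y ^ (-q) = (1 - (q - 1) * (w - 1)) * y ^ (1 - q) - y ^ (1 - q) := by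
        rw [e2, hx']; ring
    _ ≤ x ^ (1 - q) - y ^ (1 - q) := by
        rw [e1]
        gcongr

/-- Comparison with the integral of `x^(1-q)`; the induction step is Bernoulli's inequality for the
concave power `2 - q`. -/
theorem sum_Icc_rpow_one_sub_le {q : ℝ} (hq1 : 1 < q) (hq2 : q < 2) (n : ℕ) :
    ∑ l ∈ Finset.Icc 1 n, (l : ℝ) ^ (1 - q) ≤ (2 - q)⁻¹ * (n : ℝ) ^ (2 - q) := by
  induction n with
  | zero => simp [Real.zero_rpow (by linarith : 2 - q ≠ 0)]
  | succ n ih =>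
    rw [Finset.sum_Icc_succ_top (by omega)]
    set y : ℝ := ((n + 1 : ℕ) : ℝ) with hy
    have hyn : (n : ℝ) = y - 1 := by rw [hy]; push_cast; ring
    have hy1 : 1 ≤ y := by rw [hy]; push_cast; linarith [Nat.cast_nonneg (α := ℝ) n]
    have hy0 : 0 < y := by linarith
    have h1 := rpow_one_add_le_one_add_mul_self (s := -y⁻¹)
      (by linarith [inv_le_one_of_one_le₀ hy1]) (p := 2 - q) (by linarith) (by linarith)
    have h2 : (n : ℝ) ^ (2 - q) = (1 + -y⁻¹) ^ (2 - q) * y ^ (2 - q) := by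
      rw [← Real.mul_rpow (by linarith [inv_le_one_of_one_le₀ hy1]) hy0.le, hyn]
      congr 1
      field_simp
      ring
    have e : y ^ (2 - q) = y * y ^ (1 - q) := by
      rw [show 2 - q = (1 - q) + 1 by ring, Real.rpow_add_one hy0.ne']; ring
    have h3 : (n : ℝ) ^ (2 - q) ≤ y ^ (2 - q) - (2 - q) * y ^ (1 - q) := by
      rw [h2]
      refine (mul_le_mul_of_nonneg_right h1 (by positivity)).trans (le_of_eq ?_)
      rw [e]
      field_simp
      ring
    have h4 : (2 - q)⁻¹ * (n : ℝ) ^ (2 - q) ≤ (2 - q)⁻¹ * y ^ (2 - q) - y ^ (1 - q) := by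
      have hp : 0 < (2 - q)⁻¹ := inv_pos.2 (by linarith)
      have := mul_le_mul_of_nonneg_left h3 hp.le
      rwa [mul_sub, ← mul_assoc, inv_mul_cancel₀ (by linarith : 2 - q ≠ 0), one_mul] at this
    linarith

/-! ### The Lyapunov function and its decrements -/

/-- The part of the Lyapunov function that controls how the mass moves from size `l` to larger
sizes, before a fraction `r ^ l` of it has done so. -/
noncomputable def chainTerm (q r : ℝ) (N : ℕ) (L : ℕ → ℕ) (l : ℕ) : ℝ :=
  4 * (l : ℝ) ^ (1 - q) * r⁻¹ ^ (l - 1)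
    * max 0 (smallMass L (l + 1) / N - (1 - r ^ l - l / N))

/-- The part of the Lyapunov function that controls the growth of the largest particle. -/
noncomputable def growthTerm (q C : ℝ) (N k : ℕ) (L : ℕ → ℕ) : ℝ :=
  C * ((max k (maxSize N L) : ℕ) : ℝ) ^ (1 - q)

/-- The Lyapunov function. -/
noncomputable def lyapunov (q r C : ℝ) (N k : ℕ) (L : ℕ → ℕ) : ℝ :=
  ∑ l ∈ Finset.Icc 1 (k - 1), chainTerm q r N L l + growthTerm q C N k L

section Lyapunov

variable {q r C : ℝ} {N k : ℕ} {L : ℕ → ℕ}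

theorem lyapunov_nonneg (hr : 0 < r) (hC : 0 ≤ C) : 0 ≤ lyapunov q r C N k L := by
  unfold lyapunov chainTerm growthTerm
  positivity

theorem lyapunov_le (hq1 : 1 < q) (hr : 0 < r) (hC : 0 ≤ C) (hk : 1 ≤ k) (hkN : k ≤ N)
    (hL : L ∈ stateSpace N) :
    lyapunov q r C N k L ≤
      ∑ l ∈ Finset.Icc 1 (k - 1), 4 * (l : ℝ) ^ (1 - q) * r⁻¹ ^ (l - 1) * (r ^ l + l / N)
        + C * (k : ℝ) ^ (1 - q) := by
  unfold lyapunov chainTerm growthTerm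
  refine add_le_add (Finset.sum_le_sum fun l hl => ?_) ?_
  · rw [Finset.mem_Icc] at hl
    have h1 := smallMass_le hL (by omega : l + 1 ≤ N)
    have hN : (0 : ℝ) < N := by exact_mod_cast (by omega : 0 < N)
    have h2 : smallMass L (l + 1) / N ≤ 1 := (div_le_one hN).2 h1
    have h3 : max 0 (smallMass L (l + 1) / N - (1 - r ^ l - l / N)) ≤ r ^ l + l / N :=
      max_le (by positivity) (by linarith)
    gcongr
  · refine mul_le_mul_of_nonneg_left ?_ hC
    refine Real.rpow_le_rpow_of_nonpos (by exact_mod_cast hk) ?_ (by linarith)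
    exact_mod_cast le_max_left _ _

theorem chainTerm_coagulate_le (hr : 0 < r) {m n : ℕ} (h : CanMerge L m n) (l : ℕ) :
    chainTerm q r N (coagulate L m n) l ≤ chainTerm q r N L l := by
  unfold chainTerm
  have := smallMass_coagulate_le h (l + 1)
  gcongr

theorem growthTerm_coagulate_le (hq1 : 1 < q) (hC : 0 ≤ C) (hk : 1 ≤ k) {m n : ℕ}
    (hm : m ∈ Finset.Icc 1 N) (hn : n ∈ Finset.Icc 1 N) :
    growthTerm q C N k (coagulate L m n) ≤ growthTerm q C N k L := by
  unfold growthTerm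
  refine mul_le_mul_of_nonneg_left ?_ hC
  refine Real.rpow_le_rpow_of_nonpos ?_ ?_ (by linarith)
  · exact_mod_cast lt_max_of_lt_left hk
  · exact_mod_cast max_le_max le_rfl (maxSize_le_coagulate L hm hn)

theorem lyapunov_coagulate_le (hq1 : 1 < q) (hr : 0 < r) (hC : 0 ≤ C) (hk : 1 ≤ k) {m n : ℕ}
    (hm : m ∈ Finset.Icc 1 N) (hn : n ∈ Finset.Icc 1 N) (h : CanMerge L m n) :
    lyapunov q r C N k (coagulate L m n) ≤ lyapunov q r C N k L :=
  add_le_add (Finset.sum_le_sum fun l _ => chainTerm_coagulate_le hr h l)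
    (growthTerm_coagulate_le hq1 hC hk hm hn)

/-- The offset `l/N` in `chainTerm` serves here: above the level `1 - r^m` there is a margin `m/N`
before the positive part vanishes, so the whole loss of mass `m` is felt. -/
theorem lyapunov_coagulate_le_sub_of_chainTerm (hq1 : 1 < q) (hr : 0 < r) (hC : 0 ≤ C)
    (hk : 1 ≤ k) {m n : ℕ} (hm : m ∈ Finset.Icc 1 N) (hn : n ∈ Finset.Icc 1 N)
    (h : CanMerge L m n) (hmk : m ∈ Finset.Icc 1 (k - 1))
    (hS : 1 - r ^ m < smallMass L (m + 1) / N) :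
    lyapunov q r C N k (coagulate L m n) ≤
      lyapunov q r C N k L - 4 * (m : ℝ) ^ (1 - q) * r⁻¹ ^ (m - 1) * (m / N) := by
  have hchain : chainTerm q r N (coagulate L m n) m ≤
      chainTerm q r N L m - 4 * (m : ℝ) ^ (1 - q) * r⁻¹ ^ (m - 1) * (m / N) := by
    have h1 := smallMass_coagulate_succ_le h (Finset.mem_Icc.1 hn).1
    have h2 : smallMass (coagulate L m n) (m + 1) / N ≤ smallMass L (m + 1) / N - m / N := by
      rw [← sub_div]
      gcongr
    unfold chainTerm
    rw [← mul_sub]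
    refine mul_le_mul_of_nonneg_left ?_ (by positivity)
    have h3 : (0 : ℝ) ≤ m / N := by positivity
    rw [max_eq_right (by linarith : 0 ≤ smallMass L (m + 1) / N - (1 - r ^ m - m / N))]
    exact max_le (by linarith) (by linarith)
  have hsum : ∑ l ∈ Finset.Icc 1 (k - 1), chainTerm q r N (coagulate L m n) l ≤
      ∑ l ∈ Finset.Icc 1 (k - 1), (chainTerm q r N L l
        - if l = m then 4 * (m : ℝ) ^ (1 - q) * r⁻¹ ^ (m - 1) * (m / N) else 0) := by
    refine Finset.sum_le_sum fun l _ => ?_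
    split_ifs with e
    · rw [e]
      exact hchain
    · rw [sub_zero]
      exact chainTerm_coagulate_le hr h l
  rw [Finset.sum_sub_distrib, Finset.sum_ite_eq', if_pos hmk] at hsum
  have := growthTerm_coagulate_le (L := L) hq1 hC hk hm hn
  unfold lyapunov
  linarith

/-- The largest size grows from `M` to at least `M + n`. The tangent bound is taken at `M + n`,
which is at most `2 * M` because `n < k ≤ M`. -/
theorem lyapunov_coagulate_le_sub_of_growthTerm (hq1 : 1 < q) (hq2 : q < 2) (hr : 0 < r)
    (hC : 0 ≤ C) {n : ℕ} (hkM : k ≤ maxSize N L)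
    (hM : maxSize N L ∈ Finset.Icc 1 N) (hn : n ∈ Finset.Icc 1 N) (h : CanMerge L (maxSize N L) n)
    (hnk : n < k) :
    lyapunov q r C N k (coagulate L (maxSize N L) n) ≤
      lyapunov q r C N k L - C * ((q - 1) * n * (2 * (maxSize N L : ℝ)) ^ (-q)) := by
  set M := maxSize N L with hMdef
  have hM1 : (1 : ℝ) ≤ M := by exact_mod_cast (Finset.mem_Icc.1 hM).1
  have hn0 : (0 : ℝ) ≤ n := Nat.cast_nonneg n
  have hchain : ∑ l ∈ Finset.Icc 1 (k - 1), chainTerm q r N (coagulate L M n) l ≤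
      ∑ l ∈ Finset.Icc 1 (k - 1), chainTerm q r N L l :=
    Finset.sum_le_sum fun l _ => chainTerm_coagulate_le hr h l
  have h1 : growthTerm q C N k (coagulate L M n) ≤ C * ((M : ℝ) + n) ^ (1 - q) := by
    unfold growthTerm
    refine mul_le_mul_of_nonneg_left ?_ hC
    refine Real.rpow_le_rpow_of_nonpos (by positivity) ?_ (by linarith)
    exact_mod_cast le_max_of_le_right (add_le_maxSize_coagulate L hM hn)
  have h2 : growthTerm q C N k L = C * (M : ℝ) ^ (1 - q) := by
    unfold growthTerm
    rw [max_eq_right hkM]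
  have h3 := rpow_one_sub_sub_ge hq1 hq2 (by linarith : (0 : ℝ) < M)
    (by linarith : (M : ℝ) ≤ (M : ℝ) + n)
  rw [add_sub_cancel_left] at h3
  have h4 : (2 * (M : ℝ)) ^ (-q) ≤ ((M : ℝ) + n) ^ (-q) := by
    refine Real.rpow_le_rpow_of_nonpos (by positivity) ?_ (by linarith)
    have : (n : ℝ) ≤ M := by exact_mod_cast (hnk.trans_le hkM).le
    linarith
  have h5 : (q - 1) * n * (2 * (M : ℝ)) ^ (-q) ≤ (M : ℝ) ^ (1 - q) - ((M : ℝ) + n) ^ (1 - q) := by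
    refine le_trans ?_ h3
    have : 0 ≤ (q - 1) * n := mul_nonneg (by linarith) hn0
    gcongr
  have h6 := mul_le_mul_of_nonneg_left h5 hC
  unfold lyapunov
  rw [h2]
  linarith

/-! ### Drift estimates -/

variable {α : ℕ → ℕ → ℝ}

theorem generator_lyapunov_nonpos (hα : ∀ m n, 1 ≤ m → 1 ≤ n → 0 ≤ α m n) (hq1 : 1 < q)
    (hr : 0 < r) (hC : 0 ≤ C) (hk : 1 ≤ k) (hN : 1 ≤ N) :
    generator α N (lyapunov q r C N k) L ≤ 0 := by
  have hF := fun m (hm : m ∈ Finset.Icc 1 N) n (hn : n ∈ Finset.Icc 1 N) (h : CanMerge L m n) =>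
    lyapunov_coagulate_le hq1 hr hC hk hm hn h
  have h1 : 1 ∈ Finset.Icc 1 N := by simp [hN]
  have := generator_le_neg_sum hα hF h1 (fun _ => 0) fun n hn h => by
    simpa using hF 1 h1 n hn h
  simpa using this

/-- As long as little mass has reached size `k`, there is a size `l < k` from which mass moves fast
enough. -/
theorem generator_lyapunov_le_of_smallMass_gt
    (hα : ∀ m n : ℕ, 1 ≤ m → 1 ≤ n → (m : ℝ) ^ q + (n : ℝ) ^ q ≤ α m n) (hq1 : 1 < q)
    (hr : 0 < r) (hr4 : r ≤ 1 / 4) (hC : 0 ≤ C) (hk : 1 ≤ k) (hkN : 4 * k ≤ N)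
    (hL : L ∈ stateSpace N) (hS : 1 - r ^ (k - 1) < smallMass L k / N) :
    generator α N (lyapunov q r C N k) L ≤ -1 := by
  have hα0 : ∀ m n, 1 ≤ m → 1 ≤ n → 0 ≤ α m n := fun m n hm hn =>
    le_trans (by positivity) (hα m n hm hn)
  -- The first level crossing: `S_(j+1)/N ≤ 1 - r^j` holds for `j = 0`, both sides being zero, and
  -- fails for `j = k - 1`.
  obtain ⟨l, hl1, hlk, hSl, hSl'⟩ : ∃ l, 1 ≤ l ∧ l < k ∧ smallMass L l / N ≤ 1 - r ^ (l - 1) ∧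
      1 - r ^ l < smallMass L (l + 1) / N := by
    by_contra! hcon
    have : ∀ j, j + 1 ≤ k → smallMass L (j + 1) / N ≤ 1 - r ^ j := by
      intro j
      induction j with
      | zero => intro _; simp [smallMass]
      | succ j ih => intro hj; exact hcon (j + 1) (by omega) (by omega) (by simpa using ih (by omega))
    have h := this (k - 1) (by omega)
    rw [Nat.sub_add_cancel hk] at h
    exact absurd hS (not_lt.2 h)
  have hl : l ∈ Finset.Icc 1 N := Finset.mem_Icc.2 ⟨hl1, by omega⟩
  have hN : (0 : ℝ) < N := by exact_mod_cast (by omega : 0 < N)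
  have hl0 : (0 : ℝ) < l := by exact_mod_cast hl1
  refine (generator_le_neg_sum hα0
    (fun m hm n hn h => lyapunov_coagulate_le hq1 hr hC hk hm hn h) hl
    (fun _ => 4 * (l : ℝ) ^ (1 - q) * r⁻¹ ^ (l - 1) * (l / N)) fun n hn h =>
      lyapunov_coagulate_le_sub_of_chainTerm hq1 hr hC hk hl hn h
        (Finset.mem_Icc.2 ⟨hl1, by omega⟩) hSl').trans ?_
  rw [← Finset.sum_mul, neg_le_neg_iff]
  refine le_trans ?_ (mul_le_mul_of_nonneg_right (le_sum_mergeRate hq1 hL hα hl) (by positivity))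
  have hrp : 0 < r ^ (l - 1) := by positivity
  -- Subtracting the two levels leaves `r^(l-1) - r^l` at size `l`, and `r ≤ 1/4`.
  have hmass : r ^ (l - 1) * (3 / 4) ≤ l * L l / N := by
    rw [smallMass_succ, add_div] at hSl'
    have e : r ^ l = r ^ (l - 1) * r := by rw [← pow_succ, Nat.sub_add_cancel hl1]
    nlinarith
  have hfrac : (3 : ℝ) / 4 ≤ (N - l) / N := by
    rw [le_div_iff₀ hN]
    have : (4 : ℝ) * l ≤ N := by exact_mod_cast (by omega : 4 * l ≤ N)
    linarith
  have e1 : (l : ℝ) ^ (q - 1) * (l : ℝ) ^ (1 - q) = 1 := by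
    rw [← Real.rpow_add hl0]; simp
  have e2 : r ^ (l - 1) * r⁻¹ ^ (l - 1) = 1 := by
    rw [← mul_pow, mul_inv_cancel₀ hr.ne', one_pow]
  -- The factor `4` in `chainTerm` is chosen here: halved by the rate and reduced by two factors
  -- `3/4`, it leaves `9/8`.
  calc (1 : ℝ) ≤ 2 * (((3 : ℝ) / 4) * (3 / 4)) * (r ^ (l - 1) * r⁻¹ ^ (l - 1)) := by
        rw [e2]; norm_num
    _ = 2 * ((3 / 4) * (r ^ (l - 1) * (3 / 4))) * r⁻¹ ^ (l - 1) := by ring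
    _ ≤ 2 * ((N - l) / N * (l * L l / N)) * r⁻¹ ^ (l - 1) := by gcongr
    _ = 2 * ((N - l) / N * (l * L l / N)) * r⁻¹ ^ (l - 1)
          * ((l : ℝ) ^ (q - 1) * (l : ℝ) ^ (1 - q)) := by rw [e1, mul_one]
    _ = _ := by ring

/-- Once there is a particle of size at least `k`, the largest particle grows fast enough as long as
the smaller particles carry a mass fraction greater than `1 - δ`. -/
theorem generator_lyapunov_le_of_smallMass_lt
    (hα : ∀ m n : ℕ, 1 ≤ m → 1 ≤ n → (m : ℝ) ^ q + (n : ℝ) ^ q ≤ α m n) (hq1 : 1 < q)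
    (hq2 : q < 2) (hr : 0 < r) {δ : ℝ} (hδ : δ < 1) (hk : 1 ≤ k) (hkN : k ≤ N)
    (hL : L ∈ stateSpace N) (hS : smallMass L k < N) (hS' : 1 - δ < smallMass L k / N) :
    generator α N (lyapunov q r (2 ^ (q + 1) / (q - 1) * (1 - δ)⁻¹) N k) L ≤ -1 := by
  have hα0 : ∀ m n, 1 ≤ m → 1 ≤ n → 0 ≤ α m n := fun m n hm hn =>
    le_trans (by positivity) (hα m n hm hn)
  have hδ' : 0 < 1 - δ := by linarith
  have hq' : 0 < q - 1 := by linarith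
  -- Cancels the `1/2` in the rate, the `2^(-q)` from `(2 * M)^(-q)`, the slope `q - 1` and the
  -- lower bound `1 - δ` for `S_k/N`.
  set C : ℝ := 2 ^ (q + 1) / (q - 1) * (1 - δ)⁻¹ with hCdef
  have hC : 0 ≤ C := by positivity
  obtain ⟨hkM, hMN, hM0⟩ := maxSize_spec hL hk hkN hS
  set M := maxSize N L with hMdef
  have hM : M ∈ Finset.Icc 1 N := Finset.mem_Icc.2 ⟨by omega, hMN⟩
  have hM1 : (0 : ℝ) < M := by exact_mod_cast (by omega : 0 < M)
  have hN : (0 : ℝ) < N := by exact_mod_cast (by omega : 0 < N)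
  refine (generator_le_neg_sum hα0
    (fun m hm n hn h => lyapunov_coagulate_le hq1 hr hC hk hm hn h) hM
    (fun n => if n < k then C * ((q - 1) * n * (2 * (M : ℝ)) ^ (-q)) else 0)
    fun n hn h => ?_).trans ?_
  · split_ifs with hnk
    · exact lyapunov_coagulate_le_sub_of_growthTerm hq1 hq2 hr hC hkM hM hn h hnk
    · rw [sub_zero]
      exact lyapunov_coagulate_le hq1 hr hC hk hM hn h
  rw [neg_le_neg_iff]
  set D : ℝ := (M : ℝ) ^ q / (2 * N) * (C * ((q - 1) * (2 * (M : ℝ)) ^ (-q))) with hD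
  have hD0 : 0 ≤ D := by positivity
  have hterm : ∀ n ∈ Finset.Icc 1 N, (if n < k then D * ((n : ℝ) * L n) else 0) ≤
      mergeRate α N L M n * (if n < k then C * ((q - 1) * n * (2 * (M : ℝ)) ^ (-q)) else 0) := by
    intro n hn
    split_ifs with hnk
    · have hn1 := (Finset.mem_Icc.1 hn).1
      have hrate : (M : ℝ) ^ q / (2 * N) * L n ≤ mergeRate α N L M n := by
        unfold mergeRate
        -- Since `n < k ≤ M`, the sizes differ and there is no self-pair correction.
        rw [if_neg (by omega), sub_zero]
        have h1 : (M : ℝ) ^ q ≤ α M n :=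
          le_trans (by linarith [Real.rpow_nonneg (Nat.cast_nonneg (α := ℝ) n) q])
            (hα M n (by omega) hn1)
        have h2 : (1 : ℝ) * L n ≤ L M * L n := by
          have : (1 : ℝ) ≤ L M := by exact_mod_cast Nat.one_le_iff_ne_zero.2 hM0
          gcongr
        rw [one_mul] at h2
        have h3 : 0 ≤ α M n := hα0 M n (by omega) hn1
        gcongr
      refine le_trans (le_of_eq ?_) (mul_le_mul_of_nonneg_right hrate (by positivity))
      rw [hD]
      ring
    · simp
  refine le_trans ?_ (Finset.sum_le_sum hterm)
  have hsum : ∑ n ∈ Finset.Icc 1 N, (if n < k then D * ((n : ℝ) * L n) else 0)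
      = D * smallMass L k := by
    rw [← Finset.sum_filter, ← Finset.mul_sum]
    congr 1
    unfold smallMass
    refine Finset.sum_subset ?_ ?_
    · intro n hn
      exact Finset.mem_range.2 (Finset.mem_filter.1 hn).2
    · intro n hn hn'
      have h0 : n = 0 := by
        by_contra h0
        have := Finset.mem_range.1 hn
        exact hn' (Finset.mem_filter.2 ⟨Finset.mem_Icc.2 ⟨by omega, by omega⟩, this⟩)
      simp [h0]
  rw [hsum]
  have e1 : (2 * (M : ℝ)) ^ (-q) = 2 ^ (-q) * (M : ℝ) ^ (-q) :=
    Real.mul_rpow (by norm_num) hM1.le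
  have e2 : (M : ℝ) ^ q * (M : ℝ) ^ (-q) = 1 := by rw [← Real.rpow_add hM1]; simp
  have e3 : (2 : ℝ) ^ (q + 1) * 2 ^ (-q) = 2 := by
    rw [← Real.rpow_add (by norm_num)]; simp
  have e4 : D * smallMass L k = (smallMass L k / N) * (1 - δ)⁻¹ := by
    calc D * smallMass L k = ((M : ℝ) ^ q * (M : ℝ) ^ (-q)) * ((2 : ℝ) ^ (q + 1) * 2 ^ (-q)) / 2
          * ((q - 1) / (q - 1)) * ((smallMass L k / N) * (1 - δ)⁻¹) := by
          rw [hD, hCdef, e1]; ring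
      _ = (smallMass L k / N) * (1 - δ)⁻¹ := by
          rw [e2, e3, div_self hq'.ne']; ring
  rw [e4, ← div_eq_mul_inv, one_le_div hδ']
  exact hS'.le

/-- The regimes are split at `S_k/N = 1 - r^(k-1)`. At or below it `S_k < N`, so a particle of size
at least `k` exists. -/
theorem generator_lyapunov_le
    (hα : ∀ m n : ℕ, 1 ≤ m → 1 ≤ n → (m : ℝ) ^ q + (n : ℝ) ^ q ≤ α m n) (hq1 : 1 < q)
    (hq2 : q < 2) (hr : 0 < r) (hr4 : r ≤ 1 / 4) {δ : ℝ} (hδ : δ < 1) (hk : 1 ≤ k)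
    (hkN : 4 * k ≤ N) (hL : L ∈ stateSpace N) (hmass : massFraction N k L < δ) :
    generator α N (lyapunov q r (2 ^ (q + 1) / (q - 1) * (1 - δ)⁻¹) N k) L ≤ -1 := by
  have hδ' : 0 < 1 - δ := by linarith
  have hq' : 0 < q - 1 := by linarith
  rcases lt_or_ge (1 - r ^ (k - 1)) (smallMass L k / N) with hS | hS
  · exact generator_lyapunov_le_of_smallMass_gt hα hq1 hr hr4 (by positivity) hk hkN hL hS
  · rw [massFraction_eq hL (by omega) (by omega)] at hmass
    have hN : (0 : ℝ) < N := by exact_mod_cast (by omega : 0 < N)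
    have : smallMass L k / N < 1 := by
      have : 0 < r ^ (k - 1) := by positivity
      linarith
    exact generator_lyapunov_le_of_smallMass_lt hα hq1 hq2 hr hδ hk (by omega) hL
      ((div_lt_one hN).1 this) (by linarith)

end Lyapunov

/-! ### Bound for the chain sum -/

/-- The initial value of the Lyapunov function, for `r = k ^ (-s)`. -/
theorem sum_chain_le {q s : ℝ} (hq1 : 1 < q) (hq2 : q < 2) (hs : 0 < s) {k N : ℕ} (hk : 1 ≤ k) :
    ∑ l ∈ Finset.Icc 1 (k - 1), 4 * (l : ℝ) ^ (1 - q) * ((k : ℝ) ^ (-s))⁻¹ ^ (l - 1)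
        * (((k : ℝ) ^ (-s)) ^ l + l / N) ≤
      4 * (2 - q)⁻¹ * (k : ℝ) ^ (-s + 2 - q)
        + 8 * (k : ℝ) ^ (s * ((k : ℝ) - 1) + 3 - q) * (N : ℝ)⁻¹ := by
  have hk0 : (0 : ℝ) < k := by exact_mod_cast hk
  have hk1 : (1 : ℝ) ≤ k := by exact_mod_cast hk
  have hcast : ((k - 1 : ℕ) : ℝ) = (k : ℝ) - 1 := by push_cast [hk]; ring
  set r : ℝ := (k : ℝ) ^ (-s) with hr
  have hr0 : 0 < r := by positivity
  have hterm : ∀ l ∈ Finset.Icc 1 (k - 1), 4 * (l : ℝ) ^ (1 - q) * r⁻¹ ^ (l - 1)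
      * (r ^ l + l / N) ≤ 4 * r * (l : ℝ) ^ (1 - q)
        + 4 * (k : ℝ) ^ (2 - q) * (k : ℝ) ^ (s * ((k : ℝ) - 1)) * (N : ℝ)⁻¹ := by
    intro l hl
    rw [Finset.mem_Icc] at hl
    have hl0 : (0 : ℝ) < l := by exact_mod_cast hl.1
    -- The weight cancels all but one factor `r`, leaving `r * l^(1-q)` to sum. The `l/N` part is
    -- bounded termwise, with `r^(-(l-1)) ≤ k^(s(k-1))`.
    have e1 : r⁻¹ ^ (l - 1) * r ^ l = r := by
      have : r ^ l = r ^ (l - 1) * r := by rw [← pow_succ, Nat.sub_add_cancel hl.1]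
      rw [this, ← mul_assoc, ← mul_pow, inv_mul_cancel₀ hr0.ne', one_pow, one_mul]
    have e2 : (l : ℝ) ^ (1 - q) * l = (l : ℝ) ^ (2 - q) := by
      rw [← Real.rpow_add_one hl0.ne']; ring_nf
    have e3 : r⁻¹ ^ (l - 1) ≤ (k : ℝ) ^ (s * ((k : ℝ) - 1)) := by
      rw [hr, ← Real.rpow_neg hk0.le, neg_neg, ← Real.rpow_natCast, ← Real.rpow_mul hk0.le]
      refine Real.rpow_le_rpow_of_exponent_le hk1 (mul_le_mul_of_nonneg_left ?_ hs.le)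
      rw [← hcast]
      exact_mod_cast (by omega : l - 1 ≤ k - 1)
    have e4 : (l : ℝ) ^ (2 - q) ≤ (k : ℝ) ^ (2 - q) :=
      Real.rpow_le_rpow hl0.le (by exact_mod_cast (by omega : l ≤ k)) (by linarith)
    calc 4 * (l : ℝ) ^ (1 - q) * r⁻¹ ^ (l - 1) * (r ^ l + l / N)
        = 4 * (r⁻¹ ^ (l - 1) * r ^ l) * (l : ℝ) ^ (1 - q)
          + 4 * ((l : ℝ) ^ (1 - q) * l) * r⁻¹ ^ (l - 1) * (N : ℝ)⁻¹ := by ring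
      _ ≤ _ := by
        rw [e1, e2]
        gcongr
  refine (Finset.sum_le_sum hterm).trans ?_
  rw [Finset.sum_add_distrib, ← Finset.mul_sum, Finset.sum_const, Nat.card_Icc, nsmul_eq_mul]
  have h1 := sum_Icc_rpow_one_sub_le hq1 hq2 (k - 1)
  have h2 : ((k - 1 : ℕ) : ℝ) ^ (2 - q) ≤ (k : ℝ) ^ (2 - q) :=
    Real.rpow_le_rpow (by positivity) (by exact_mod_cast (by omega : k - 1 ≤ k)) (by linarith)
  have e5 : r * (k : ℝ) ^ (2 - q) = (k : ℝ) ^ (-s + 2 - q) := by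
    rw [hr, ← Real.rpow_add hk0]; ring_nf
  have e6 : (k : ℝ) * ((k : ℝ) ^ (2 - q) * (k : ℝ) ^ (s * ((k : ℝ) - 1)))
      = (k : ℝ) ^ (s * ((k : ℝ) - 1) + 3 - q) := by
    rw [← Real.rpow_add hk0, mul_comm, ← Real.rpow_add_one hk0.ne']; ring_nf
  have hp : 0 < (2 - q)⁻¹ := inv_pos.2 (by linarith)
  refine add_le_add ?_ ?_
  · calc 4 * r * ∑ l ∈ Finset.Icc 1 (k - 1), (l : ℝ) ^ (1 - q)
        ≤ 4 * r * ((2 - q)⁻¹ * (k : ℝ) ^ (2 - q)) := by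
          gcongr
          exact h1.trans (by gcongr)
      _ = 4 * (2 - q)⁻¹ * (k : ℝ) ^ (-s + 2 - q) := by rw [← e5]; ring
  · rw [← e6]
    have h3 : ((k - 1 + 1 - 1 : ℕ) : ℝ) ≤ k := by exact_mod_cast (by omega : k - 1 + 1 - 1 ≤ k)
    calc ((k - 1 + 1 - 1 : ℕ) : ℝ) * (4 * (k : ℝ) ^ (2 - q) * (k : ℝ) ^ (s * ((k : ℝ) - 1))
          * (N : ℝ)⁻¹)
        ≤ (k : ℝ) * (4 * (k : ℝ) ^ (2 - q) * (k : ℝ) ^ (s * ((k : ℝ) - 1)) * (N : ℝ)⁻¹) := by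
          gcongr
      _ = 4 * ((k : ℝ) * ((k : ℝ) ^ (2 - q) * (k : ℝ) ^ (s * ((k : ℝ) - 1))) * (N : ℝ)⁻¹) := by
          ring
      _ ≤ 8 * ((k : ℝ) * ((k : ℝ) ^ (2 - q) * (k : ℝ) ^ (s * ((k : ℝ) - 1))) * (N : ℝ)⁻¹) := by
          gcongr
          norm_num
      _ = _ := by ring

end MarcusLushnikov

/-! ### Choice of constants and conclusion -/

theorem theorem3p1 (q s η : ℝ) (hq1 : 1 < q) (hq2 : q < 2) (hs : 2 - q < s)
    (hη0 : 0 < η) (hη1 : η < (q - 1) / 4) :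
    ∃ k₀ : ℝ, 0 < k₀ ∧ ∀ ν : ℝ, 1 < ν → ∃ C₁ : ℝ, 0 < C₁ ∧
      ∀ α : ℕ → ℕ → ℝ,
        (∀ m n : ℕ, 1 ≤ m → 1 ≤ n → α m n = α n m) →
        (∀ m n : ℕ, 1 ≤ m → 1 ≤ n → (m : ℝ) ^ q + (n : ℝ) ^ q ≤ α m n) →
      ∀ δ : ℝ, 0 < δ → δ < 1 →
      ∀ k N : ℕ, k₀ < (k : ℝ) →
        (k : ℝ) ^ (((k : ℝ) - 1) * s + 2) ≤ (N : ℝ) →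
        (N : ℝ) ≤ Real.exp ((k : ℝ) ^ ν) →
        2 * (k : ℝ) ^ (-s) ≤ 1 →
      ∀ {Ω : Type*} [MeasurableSpace Ω] (μ : Measure Ω) [IsProbabilityMeasure μ]
        (X : ℝ≥0 → Ω → (ℕ → ℕ)), MarcusLushnikov.IsMarcusLushnikov α N μ X →
        ∫⁻ ω, MarcusLushnikov.hittingTime N X k δ ω ∂μ ≤
          ENNReal.ofReal
            (4 * (2 - q)⁻¹ * (k : ℝ) ^ (-s + 2 - q)
              + 8 * (k : ℝ) ^ (s * ((k : ℝ) - 1) + 3 - q) * (N : ℝ)⁻¹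
              + C₁ * (1 - δ)⁻¹ * (k : ℝ) ^ (-η) * (Real.log k) ^ (1 - η)
              + C₁ * (1 - δ)⁻¹ * (k : ℝ) ^ (3 - q / 2) * (Real.log k) ^ 3
                * (N : ℝ) ^ (-q / (2 * s * ((k : ℝ) - 1)))) := by

  have hs0 : 0 < s := by linarith
  -- `k > 4` yields `log k ≥ 1` and `4k ≤ k^2 ≤ N`, while `k > 4^(1/s)` yields `r = k^(-s) ≤ 1/4`.
  refine ⟨max 4 (4 ^ s⁻¹), by positivity, fun ν _ => ⟨2 ^ (q + 1) / (q - 1),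
    div_pos (by positivity) (by linarith), ?_⟩⟩
  intro α _ hα δ _ hδ1 k N hk hN _ _ Ω _ μ _ X hX
  have hk4 : (4 : ℝ) < k := (le_max_left _ _).trans_lt hk
  have hks : (4 : ℝ) ^ s⁻¹ < k := (le_max_right _ _).trans_lt hk
  have hk0 : (0 : ℝ) < k := by linarith
  have hk4' : 4 < k := by exact_mod_cast hk4
  have hr0 : 0 < (k : ℝ) ^ (-s) := by positivity
  have hr4 : (k : ℝ) ^ (-s) ≤ 1 / 4 := by
    have h1 : (4 : ℝ) ≤ (k : ℝ) ^ s := by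
      have := Real.rpow_le_rpow (by positivity) hks.le hs0.le
      rwa [← Real.rpow_mul (by norm_num), inv_mul_cancel₀ hs0.ne', Real.rpow_one] at this
    rw [Real.rpow_neg hk0.le, ← one_div]
    exact one_div_le_one_div_of_le (by norm_num) h1
  have hkN : 4 * k ≤ N := by
    have h1 : (k : ℝ) ^ (2 : ℝ) ≤ (k : ℝ) ^ (((k : ℝ) - 1) * s + 2) := by
      refine Real.rpow_le_rpow_of_exponent_le (by linarith) ?_
      have : 0 ≤ ((k : ℝ) - 1) * s := mul_nonneg (by linarith) hs0.le
      linarith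
    rw [Real.rpow_two] at h1
    have h2 : 4 * (k : ℝ) ≤ N := by nlinarith
    exact_mod_cast h2
  have hα0 : ∀ m n, 1 ≤ m → 1 ≤ n → 0 ≤ α m n := fun m n hm hn =>
    le_trans (by positivity) (hα m n hm hn)
  have hδ' : 0 < 1 - δ := by linarith
  have hq' : 0 < q - 1 := by linarith
  set C : ℝ := 2 ^ (q + 1) / (q - 1) with hC
  have hC0 : 0 < C := by positivity
  have hCδ : 0 ≤ C * (1 - δ)⁻¹ := by positivity
  refine (MarcusLushnikov.lintegral_hittingTime_le hX
    (MarcusLushnikov.lyapunov q ((k : ℝ) ^ (-s)) (C * (1 - δ)⁻¹) N k)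
    (fun L => MarcusLushnikov.lyapunov_nonneg hr0 hCδ)
    (fun L hL => MarcusLushnikov.lyapunov_le hq1 hr0 hCδ (by omega) (by omega) hL)
    (fun L _ => MarcusLushnikov.generator_lyapunov_nonpos hα0 hq1 hr0 hCδ (by omega) (by omega))
    (fun L hL hmass => MarcusLushnikov.generator_lyapunov_le hα hq1 hq2 hr0 hr4 hδ1 (by omega)
      hkN hL hmass)).trans (ENNReal.ofReal_le_ofReal ?_)
  have hlog : 1 ≤ Real.log k := by
    rw [Real.le_log_iff_exp_le hk0]
    linarith [Real.exp_one_lt_d9]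
  have hsum := MarcusLushnikov.sum_chain_le hq1 hq2 hs0 (N := N) (by omega : 1 ≤ k)
  have hgrowth : C * (1 - δ)⁻¹ * (k : ℝ) ^ (1 - q) ≤
      C * (1 - δ)⁻¹ * (k : ℝ) ^ (-η) * (Real.log k) ^ (1 - η) := by
    have h1 : (k : ℝ) ^ (1 - q) ≤ (k : ℝ) ^ (-η) :=
      Real.rpow_le_rpow_of_exponent_le (by linarith) (by linarith)
    have h2 : 1 ≤ (Real.log k) ^ (1 - η) := Real.one_le_rpow hlog (by linarith)
    calc C * (1 - δ)⁻¹ * (k : ℝ) ^ (1 - q) ≤ C * (1 - δ)⁻¹ * (k : ℝ) ^ (-η) * 1 := by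
          rw [mul_one]
          gcongr
      _ ≤ _ := by gcongr
  -- The first three terms already bound the supremum; the last only has to be nonnegative.
  have hrest : 0 ≤ C * (1 - δ)⁻¹ * (k : ℝ) ^ (3 - q / 2) * (Real.log k) ^ 3
      * (N : ℝ) ^ (-q / (2 * s * ((k : ℝ) - 1))) := by positivity
  linarith
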